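/- For a cardinal $\mu$, a partially ordered set is $\mu^{\mathrm{op}}$-like if no element is below $\mu$-many elements. The Noetherian type of a topological space $X$ is the least infinite cardinal $\mu$ such that $X$ has a base which, ordered by inclusion, is $\mu^{\mathrm{op}}$-like. Linear orders carry the order topology. **Theorem.** Let $\kappa$ be a singular cardinal. Then there is a compact linear order with Noetherian type $\kappa^+$. More precisely, let $\lambda=\operatorname{cf}\kappa$. There exist a partition $\langle S_\alpha\rangle_{\alpha<\lambda}$ of the set of (nonzero) limit ordinals below $\lambda^+$ into stationary subsets of $\lambda^+$ and a strictly increasing sequence $\langle\kappa_\alpha\rangle_{\alpha<\lambda}$ of regular (infinite) cardinals with supremum $\kappa$. For any such partition and sequence, put $Y_\beta=(\kappa_\alpha+1)^{\mathrm{op}}$ (the ordinal $\kappa_\alpha+1$ with reversed order) if $\alpha<\lambda$ and $\beta\in S_\alpha$, and let $Y_\beta=1$ be a single point for every other $\beta\in\lambda^++1$. Then $Y=\bigcup_{\beta\in\lambda^++1}\{\beta\}\times Y_\beta$, ordered lexicographically, is compact and has Noetherian type $\kappa^+$. -/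

import Mathlib

universe u

open Cardinal Order Set

/-- A preorder `P` is `μ`-op-like if no element lies below `μ`-many (i.e. at least `μ`) elements. -/
def IsOpLike (μ : Cardinal.{u}) (P : Type u) [Preorder P] : Prop :=
  ∀ p : P, #{q : P // p ≤ q} < μ

/-- The Noetherian type of a space `X`: the least infinite cardinal `μ` such that `X` has a base
which, ordered by inclusion, is `μ`-op-like. -/
noncomputable def noetherianType (X : Type u) [TopologicalSpace X] : Cardinal.{u} :=
  sInf {μ : Cardinal.{u} | ℵ₀ ≤ μ ∧
    ∃ B : Set (Set X), TopologicalSpace.IsTopologicalBasis B ∧ IsOpLike μ B}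

/-- The cardinal `cf κ`, as a well-ordered type. -/
abbrev CofType (κ : Cardinal.{u}) : Type u := κ.ord.cof.ord.ToType

/-- The cardinal `(cf κ)⁺`, as a well-ordered type; `WithTop (SuccCofType κ)` is then the
ordinal `(cf κ)⁺ + 1`. -/
abbrev SuccCofType (κ : Cardinal.{u}) : Type u := (succ κ.ord.cof).ord.ToType

/-- The lexicographic sum over `x ∈ (cf κ)⁺ + 1` of the reversed ordinals `o x`. -/
def LexSum (κ : Cardinal.{u}) (o : WithTop (SuccCofType κ) → Ordinal.{u}) : Type u :=
  Σₗ x : WithTop (SuccCofType κ), ((o x).ToType)ᵒᵈ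

noncomputable instance (κ : Cardinal.{u}) (o : WithTop (SuccCofType κ) → Ordinal.{u}) :
    LinearOrder (LexSum κ o) :=
  inferInstanceAs (LinearOrder (Σₗ x : WithTop (SuccCofType κ), ((o x).ToType)ᵒᵈ))

/-- The order topology on the lexicographic sum. -/
noncomputable instance (κ : Cardinal.{u}) (o : WithTop (SuccCofType κ) → Ordinal.{u}) :
    TopologicalSpace (LexSum κ o) :=
  Preorder.topology (LexSum κ o)

instance (κ : Cardinal.{u}) (o : WithTop (SuccCofType κ) → Ordinal.{u}) :
    OrderTopology (LexSum κ o) :=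
  ⟨rfl⟩

/-- The data of the construction: `S` partitions the limit ordinals below `(cf κ)⁺` into `cf κ`
stationary sets, `k` is a strictly increasing `cf κ`-sequence of regular cardinals with supremum
`κ`, and `o` assigns to each point of `(cf κ)⁺ + 1` an ordinal: `k α + 1` on `S α`, and `1` at
all points lying in no `S α`. -/
structure IsStationaryLexData (κ : Cardinal.{u}) (S : CofType κ → Set (SuccCofType κ))
    (k : CofType κ → Cardinal.{u}) (o : WithTop (SuccCofType κ) → Ordinal.{u}) : Prop where
  stationary : ∀ α, IsStationary (S α)
  disjoint : Pairwise fun α β => Disjoint (S α) (S β)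
  iUnion_eq : ⋃ α, S α = {β : SuccCofType κ | IsSuccLimit β}
  regular : ∀ α, (k α).IsRegular
  strictMono : StrictMono k
  isLUB : IsLUB (range k) κ
  fibre_mem : ∀ α, ∀ β ∈ S α, o (β : WithTop (SuccCofType κ)) = (k α).ord + 1
  fibre_one : ∀ x : WithTop (SuccCofType κ),
    (∀ α, ∀ β ∈ S α, x ≠ (β : WithTop (SuccCofType κ))) → o x = 1

/-! ### Clubs, stationary sets and Ulam's partition. -/

section Club

variable {T : Type u} [LinearOrder T]

/-! Write λ = cf κ. The space has at most κ points, so it has a base of size at most κ, which is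
trivially κ⁺-op-like. It remains to find, in any base, an element with at least κ supersets.

Let b ∈ S_α with κ_α > λ, and let p be the least point of the fibre over b. From the right, p has
coinitiality κ_α, so it needs κ_α basic neighbourhoods. From the left it is a limit of at most λ
fibres, so κ_α basic sets share a whole interval of fibres (g(b), b)
(`exists_le_mk_setOf_superset`). As g is regressive on the stationary set S_α, every large v has
some b ∈ S_α with g(b) < v < b. There are only λ indices α, so one v < λ⁺ serves them all. A basic
set w inside the fibres over v, v+1, v+2 then has κ_α supersets for every such α, hence κ in total
(`exists_forall_le_mk_superset`).

Compactness is order completeness: λ⁺ + 1 and every fibre are complete, and so is their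
lexicographic sum. -/

theorem noMaxOrder_of_aleph0_lt_cof (hT : ℵ₀ < cof T) : NoMaxOrder T := by
  have hne : Nonempty T := cof_ne_zero_iff.1 (aleph0_pos.trans hT).ne'
  exact (noTopOrder_iff_noMaxOrder T).1 (one_lt_cof_iff.1 (one_lt_aleph0.trans hT))

theorem bddAbove_range_of_mk_lt_cof {ι : Type u} (f : ι → T) (h : #ι < cof T) :
    BddAbove (range f) :=
  .of_not_isCofinal fun hf => (cof_le hf).not_gt (mk_range_le.trans_lt h)

theorem bddAbove_range_nat (hT : ℵ₀ < cof T) (f : ℕ → T) : BddAbove (range f) := by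
  refine .of_not_isCofinal fun hf => (cof_le hf).not_gt (hT.trans_le' ?_)
  simpa using mk_range_le_lift (f := f)

variable [WellFoundedLT T]

theorem exists_isLUB_of_bddAbove {s : Set T} (hs : BddAbove s) : ∃ a, IsLUB s a :=
  ⟨wellFounded_lt.min _ hs, wellFounded_lt.min_mem _ hs,
    fun _ hb => WellFounded.min_le wellFounded_lt hb⟩

/-- The limit points of a cofinal set form a club. -/
theorem isClub_limitPoints (hT : ℵ₀ < cof T) {D : Set T} (hD : IsCofinal D) :
    IsClub {b : T | (∃ a, a < b) ∧ ∀ c < b, ∃ d ∈ D, c < d ∧ d < b} := by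
  have := noMaxOrder_of_aleph0_lt_cof hT
  refine ⟨fun t ht ht₀ _ x hx => ⟨?_, fun c hc => ?_⟩, fun a => ?_⟩
  · obtain ⟨y, hy⟩ := ht₀
    obtain ⟨⟨a, ha⟩, -⟩ := ht hy
    exact ⟨a, ha.trans_le (hx.1 hy)⟩
  · obtain ⟨y, hy, hcy⟩ := (lt_isLUB_iff hx).1 hc
    obtain ⟨d, hd, hcd, hdy⟩ := (ht hy).2 c hcy
    exact ⟨d, hd, hcd, hdy.trans_le (hx.1 hy)⟩
  · have hstep : ∀ x : T, ∃ y ∈ D, x < y := fun x => by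
      obtain ⟨z, hz⟩ := exists_gt x
      obtain ⟨y, hy, hzy⟩ := hD z
      exact ⟨y, hy, hz.trans_le hzy⟩
    choose f hfD hf using hstep
    let g : ℕ → T := Nat.rec a fun _ x => f x
    have hg : ∀ n, g n < g (n + 1) := fun n => hf _
    obtain ⟨b, hb⟩ := exists_isLUB_of_bddAbove (bddAbove_range_nat hT g)
    have hgb : ∀ n, g n < b := fun n => (hg n).trans_le (hb.1 ⟨n + 1, rfl⟩)
    refine ⟨b, ⟨⟨a, hgb 0⟩, fun c hc => ?_⟩, (hgb 0).le⟩
    obtain ⟨_, ⟨n, rfl⟩, hn⟩ := (lt_isLUB_iff hb).1 hc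
    exact ⟨g (n + 1), hfD _, hn.trans (hg n), hgb (n + 1)⟩

theorem isClub_isSuccLimit (hT : ℵ₀ < cof T) : IsClub {b : T | IsSuccLimit b} := by
  convert isClub_limitPoints hT IsCofinal.univ using 1
  ext b
  constructor
  · intro hb
    exact ⟨not_isMin_iff.1 hb.not_isMin, fun c hc => by
      obtain ⟨d, hd⟩ := hb.lt_iff_exists_lt.1 hc
      exact ⟨d, mem_univ _, hd.2, hd.1⟩⟩
  · rintro ⟨h₁, h₂⟩
    refine ⟨not_isMin_iff.2 h₁, fun c hc => ?_⟩
    obtain ⟨d, -, h₃, h₄⟩ := h₂ c hc.lt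
    exact hc.2 h₃ h₄

theorem IsStationary.inter_isClub (hT : ℵ₀ < cof T) {s t : Set T} (hs : IsStationary s)
    (ht : IsClub t) : IsStationary (s ∩ t) := fun c hc => by
  rw [inter_assoc]
  exact hs (ht.inter hT.ne' hc)

/-- A weak form of the pressing down lemma: if `g` is regressive on a stationary set `s`, then for
all large enough `d` there is `b ∈ s` with `g b < d < b`. -/
theorem IsStationary.bddAbove_setOf_forall_le (hT : ℵ₀ < cof T) {s : Set T} (hs : IsStationary s)
    (g : T → T) (hg : ∀ b ∈ s, g b < b) :
    BddAbove {d : T | ∀ b ∈ s, d < b → d ≤ g b} := by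
  have := noMaxOrder_of_aleph0_lt_cof hT
  refine .of_not_isCofinal fun hD => ?_
  obtain ⟨b, hbs, -, hb⟩ := hs (isClub_limitPoints hT hD)
  obtain ⟨d, hd, h₁, h₂⟩ := hb _ (hg b hbs)
  exact (hd b hbs h₂).not_gt h₁

/-- Ulam's theorem: a type of order type `μ⁺` carries `μ` pairwise disjoint stationary sets. -/
theorem exists_pairwise_disjoint_isStationary {ι : Type u} (hι : ℵ₀ ≤ #ι)
    (hT : cof T = succ #ι) (hcard : ∀ x : T, #(Iio x) ≤ #ι) :
    ∃ S : ι → Set T, (∀ i, IsStationary (S i)) ∧ Pairwise fun i j => Disjoint (S i) (S j) := by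
  have hT₀ : ℵ₀ < cof T := hT ▸ hι.trans_lt (lt_succ _)
  have := noMaxOrder_of_aleph0_lt_cof hT₀
  have hne : Nonempty T := cof_ne_zero_iff.1 (aleph0_pos.trans hT₀).ne'
  have hemb : ∀ x : T, Nonempty (Iio x ↪ ι) := hcard
  let f := fun x => (hemb x).some
  -- Ulam matrix: row `y` splits the final segment above `y` into `#ι` pieces, so one piece is
  -- stationary. Within a column the sets are disjoint, since each `f x` is injective.
  let A : T → ι → Set T := fun y i => {x | ∃ h : y < x, f x ⟨y, h⟩ = i}
  have hA : ∀ y, ∃ i, IsStationary (A y i) := fun y => by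
    have hU : ⋃ i, A y i = Ioi y := by
      ext x
      simp [A]
    refine (isStationary_iUnion_iff hT₀.ne' (by simp [hT])).1 ?_
    rw [hU]
    refine .of_not_isCofinal_compl (not_isCofinal_iff_bddAbove.2 ⟨y, fun x hx => ?_⟩)
    simpa using hx
  choose a ha using hA
  obtain ⟨i, hi⟩ := infinite_pigeonhole_card a (succ #ι) (hT ▸ cof_le_cardinalMk T)
    (hι.trans (le_succ _)) (by rw [(isRegular_succ hι).cof_ord]; exact lt_succ _)
  obtain ⟨e⟩ := (le_succ #ι).trans hi
  refine ⟨fun j => A (e j).1 i, fun j => ?_, fun j k hjk => ?_⟩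
  · have : a (e j).1 = i := (e j).2
    simpa only [this] using ha (e j).1
  · refine Set.disjoint_left.2 ?_
    rintro x ⟨h₁, h₂⟩ ⟨h₃, h₄⟩
    have := (f x).injective (h₂.trans h₄.symm)
    exact hjk (e.injective (Subtype.ext (congrArg (fun z => z.1) this)))

/-- The limit elements of a type of order type `μ⁺` split into `μ` stationary sets. -/
theorem exists_stationary_partition {ι : Type u} (hι : ℵ₀ ≤ #ι)
    (hT : cof T = succ #ι) (hcard : ∀ x : T, #(Iio x) ≤ #ι) :
    ∃ S : ι → Set T, (∀ i, IsStationary (S i)) ∧ (Pairwise fun i j => Disjoint (S i) (S j)) ∧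
      ⋃ i, S i = {b : T | IsSuccLimit b} := by
  classical
  have hT₀ : ℵ₀ < cof T := hT ▸ hι.trans_lt (lt_succ _)
  obtain ⟨S, hS, hd⟩ := exists_pairwise_disjoint_isStationary hι hT hcard
  obtain ⟨i₀⟩ : Nonempty ι := mk_ne_zero_iff.1 (aleph0_pos.trans_le hι).ne'
  let L := {b : T | IsSuccLimit b}
  have hSL : ∀ i, IsStationary (S i ∩ L) := fun i =>
    (hS i).inter_isClub hT₀ (isClub_isSuccLimit hT₀)
  have hdis : ∀ {i j x}, x ∈ S i → x ∈ S j → i = j := fun {i j x} hi hj => by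
    by_contra hij
    exact Set.disjoint_left.1 (hd hij) hi hj
  -- Limits outside every `S i` are added to the piece `i₀`.
  refine ⟨fun i => {x | x ∈ L ∧ (x ∈ S i ∨ i = i₀ ∧ ∀ j, x ∉ S j)}, fun i => ?_, fun i j hij => ?_,
    ?_⟩
  · exact (hSL i).mono fun x hx => ⟨hx.2, .inl hx.1⟩
  · refine Set.disjoint_left.2 ?_
    rintro x ⟨-, h | ⟨rfl, h⟩⟩ ⟨-, h' | ⟨rfl, h'⟩⟩
    · exact hij (hdis h h')
    · exact h' _ h
    · exact h _ h'
    · exact hij rfl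
  · ext x
    simp only [mem_iUnion, mem_ofPred_eq]
    refine ⟨fun ⟨i, h, _⟩ => h, fun h => ?_⟩
    by_cases hx : ∃ i, x ∈ S i
    · obtain ⟨i, hi⟩ := hx
      exact ⟨i, h, .inl hi⟩
    · exact ⟨i₀, h, .inr ⟨rfl, not_exists.1 hx⟩⟩

end Club

/-- A limit cardinal is the supremum of a strictly increasing sequence, of length its cofinality, of
regular cardinals. -/
theorem exists_strictMono_isRegular_isLUB {κ : Cardinal.{u}} (hκ : ℵ₀ < κ) (hlim : IsSuccLimit κ) :
    ∃ k : CofType κ → Cardinal.{u}, (∀ a, (k a).IsRegular) ∧ StrictMono k ∧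
      IsLUB (range k) κ := by
  obtain ⟨s, hs, hsc⟩ := exists_cof_eq κ.ord.ToType
  rw [Ordinal.cof_toType] at hsc
  obtain ⟨e⟩ : Nonempty (CofType κ ≃ s) := Cardinal.eq.1 (by rw [hsc, mk_ord_toType])
  let f : CofType κ → Cardinal.{u} := fun a => #(Iio (e a).1)
  have hf : ∀ a, f a < κ := fun a => by
    simpa using mk_Iio_lt (e a).1 (by simp)
  have hfc : ∀ c < κ, ∃ a, c ≤ f a := fun c hc => by
    let x : κ.ord.ToType := Ordinal.enum (α := κ.ord.ToType) (· < ·) ⟨c.ord, by simpa using hc⟩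
    obtain ⟨y, hy, hxy⟩ := hs x
    refine ⟨e.symm ⟨y, hy⟩, ?_⟩
    have h₁ : #(Iio x) = c := by
      exact (Ordinal.card_typein (α := κ.ord.ToType) (r := (· < ·)) x).symm.trans
        ((congrArg Ordinal.card (Ordinal.typein_enum _ _)).trans (card_ord c))
    simp only [f, Equiv.apply_symm_apply]
    rw [← h₁]
    exact mk_le_mk_of_subset (Iio_subset_Iio hxy)
  -- The successor gives regularity, `f a` cofinality in `κ`, and the supremum of earlier values
  -- monotonicity. Values stay below `κ` because fewer than `cf κ` of them precede `a`.
  let k : CofType κ → Cardinal.{u} := wellFounded_lt.fix fun a ih =>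
    succ (max ℵ₀ (max (f a) (⨆ b : Iio a, ih b.1 b.2)))
  have hk : ∀ a, k a = succ (max ℵ₀ (max (f a) (⨆ b : Iio a, k b))) := fun a =>
    wellFounded_lt.fix_eq _ a
  have hkκ : ∀ a, k a < κ := fun a => by
    induction a using WellFoundedLT.induction with
    | ind a ih =>
      rw [hk]
      refine hlim.succ_lt (max_lt hκ (max_lt (hf a) (iSup_lt_of_lt_cof_ord ?_ fun b => ih b.1 b.2)))
      simpa using mk_Iio_lt a (by simp)
  have hmono : StrictMono k := fun b a hba => by
    rw [hk a, lt_succ_iff]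
    refine le_max_of_le_right (le_max_of_le_right ?_)
    exact le_ciSup (f := fun b : Iio a => k b) (bddAbove_of_small) ⟨b, hba⟩
  refine ⟨k, fun a => ?_, hmono, ?_, fun c hc => ?_⟩
  · rw [hk]
    exact isRegular_succ (le_max_left _ _)
  · rintro _ ⟨a, rfl⟩
    exact (hkκ a).le
  · by_contra! hcκ
    obtain ⟨a, ha⟩ := hfc c hcκ
    refine (hc ⟨a, rfl⟩).not_gt (ha.trans_lt ?_)
    rw [hk, lt_succ_iff]
    exact le_max_of_le_right (le_max_left _ _)

/-! ### Order topologies: compactness, small bases, and counting supersets. -/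

section Topology

variable {X : Type u} [LinearOrder X] [TopologicalSpace X] [OrderTopology X]

theorem compactSpace_of_forall_exists_isLUB (h : ∀ s : Set X, ∃ a, IsLUB s a) :
    CompactSpace X := by
  choose f hf using h
  let : SupSet X := ⟨f⟩
  have htop : ∀ s : Set X, BddAbove s := fun s => ⟨f univ, fun x _ => (hf univ).1 (mem_univ x)⟩
  have hbot : ∀ s : Set X, BddBelow s := fun s => ⟨f ∅, fun x _ => (hf ∅).2 (by simp)⟩
  let C : ConditionallyCompleteLattice X :=
    conditionallyCompleteLatticeOfLatticeOfsSup X fun s _ _ => hf s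
  let : ConditionallyCompleteLinearOrder X :=
    { C, (inferInstance : LinearOrder X) with
      csSup_of_not_bddAbove := fun s hs => (hs (htop s)).elim
      csInf_of_not_bddBelow := fun s hs => (hs (hbot s)).elim }
  obtain ⟨a, ha⟩ := htop Set.univ
  obtain ⟨b, hb⟩ := hbot Set.univ
  refine ⟨?_⟩
  have hI : Icc b a = (Set.univ : Set X) := eq_univ_of_forall fun x : X => ⟨hb (mem_univ x), ha (mem_univ x)⟩
  exact hI ▸ isCompact_Icc

/-- A linear order of size at most an infinite cardinal `κ` has a base of size at most `κ`. -/
theorem exists_isTopologicalBasis_mk_le {κ : Cardinal.{u}} (hκ : ℵ₀ ≤ κ) (hX : #X ≤ κ) :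
    ∃ B : Set (Set X), TopologicalSpace.IsTopologicalBasis B ∧ #B ≤ κ := by
  let s : Set (Set X) := {s | ∃ a, s = Ioi a ∨ s = Iio a}
  have hs : #s ≤ κ := by
    have : s ⊆ range (Ioi : X → Set X) ∪ range (Iio : X → Set X) := by
      rintro _ ⟨a, rfl | rfl⟩
      · exact .inl ⟨a, rfl⟩
      · exact .inr ⟨a, rfl⟩
    refine (mk_le_mk_of_subset this).trans ((mk_union_le _ _).trans ?_)
    exact add_le_of_le hκ (mk_range_le.trans hX) (mk_range_le.trans hX)
  refine ⟨_, TopologicalSpace.isTopologicalBasis_of_subbasis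
    (OrderTopology.topology_eq_generate_intervals (α := X)), ?_⟩
  refine mk_image_le.trans ?_
  let g : Finset s → Set (Set X) := fun t => (↑) '' (t : Set s)
  have : {f : Set (Set X) | f.Finite ∧ f ⊆ s} ⊆ range g := by
    rintro f ⟨hf, hfs⟩
    lift f to Set s using hfs
    exact ⟨(hf.of_finite_image Subtype.val_injective.injOn).toFinset, by simp [g]⟩
  refine (mk_le_mk_of_subset this).trans (mk_range_le.trans ?_)
  cases finite_or_infinite s
  · exact (lt_aleph0_of_finite _).le.trans hκ
  · rwa [mk_finset_of_infinite]

/-- If the coinitiality `c` of the points above `p` is regular and larger than the number of fibres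
below `p`, then some interval of fibres ending at `p` is contained in `c` many basic sets. -/
theorem exists_le_mk_setOf_superset {W : Type u} [LinearOrder W] {π : X → W} (hπ : Monotone π)
    {p : X} {c : Cardinal.{u}} (hc : c.IsRegular) (hW : #(Iio (π p)) < c) (hne : ∃ y, y < p)
    (hp : ∀ y < p, π y < π p)
    (hcoin : ∀ (ι : Type u) (f : ι → X), #ι < c → (∀ j, p < f j) → ∃ i, p < i ∧ ∀ j, i < f j)
    {B : Set (Set X)} (hB : TopologicalSpace.IsTopologicalBasis B) :
    ∃ a < π p, c ≤ #{U : Set X | U ∈ B ∧ ∀ y, a < π y → π y < π p → y ∈ U} := by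
  by_contra! h
  let N : Set (Set X) :=
    ⋃ a : Iio (π p), {U : Set X | U ∈ B ∧ ∀ y, a < π y → π y < π p → y ∈ U}
  have hN : #N < c := (card_iUnion_lt_iff_forall_of_isRegular hc hW).2 fun a => h a.1 a.2
  have hmem : ∀ U ∈ B, p ∈ U → U ∈ N := fun U hU hpU => by
    obtain ⟨l, hl, hlU⟩ := exists_Ioc_subset_of_mem_nhds (hB.mem_nhds hU hpU) hne
    refine mem_iUnion.2 ⟨⟨π l, hp l hl⟩, hU, fun y h₁ h₂ => hlU ⟨?_, ?_⟩⟩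
    · exact hπ.reflect_lt h₁
    · exact (hπ.reflect_lt h₂).le
  let M : Set (Set X) := {U | U ∈ B ∧ p ∈ U}
  have hM : #M < c := (mk_le_mk_of_subset fun U hU => hmem U hU.1 hU.2).trans_lt hN
  -- The empty family shows only that `p` is not maximal.
  obtain ⟨z, hz, -⟩ := hcoin PEmpty (fun j => j.elim) (by simpa using hc.pos) fun j => j.elim
  have hj : ∀ U : M, ∃ j ∈ U.1, p < j := fun U => by
    obtain ⟨j, hj, hjU⟩ := exists_Ico_subset_of_mem_nhds (hB.mem_nhds U.2.1 U.2.2) ⟨z, hz⟩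
    obtain ⟨i, hi, hij⟩ := hcoin PUnit (fun _ => j)
      (by simpa using one_lt_aleph0.trans_le hc.aleph0_le) fun _ => hj
    exact ⟨i, hjU ⟨hi.le, hij ⟨⟩⟩, hi⟩
  choose j hjU hj using hj
  -- Fewer than `c` basic neighbourhoods of `p` leave a point `i > p` below a chosen element of
  -- each, so none of them fits inside `Iio i`.
  obtain ⟨i, hi, hij⟩ := hcoin M j hM hj
  obtain ⟨U, hU, hpU, hUi⟩ := hB.exists_subset_of_mem_open (mem_Iio.2 hi) isOpen_Iio
  exact (hij ⟨U, hU, hpU⟩).not_gt (hUi (hjU ⟨U, hU, hpU⟩))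

theorem exists_forall_le_mk_superset {T ι : Type u} [LinearOrder T] [WellFoundedLT T]
    (hT : ℵ₀ < cof T) (hι : #ι < cof T) {π : X → WithTop T} (hπ : Monotone π)
    (hsurj : Function.Surjective π) {S : ι → Set T} (hS : ∀ i, IsStationary (S i))
    (hlim : ∀ i, ∀ b ∈ S i, IsSuccLimit b) {c : ι → Cardinal.{u}} {B : Set (Set X)}
    (hB : TopologicalSpace.IsTopologicalBasis B)
    (h : ∀ i, ∀ b ∈ S i, ∃ a < (b : WithTop T),
      c i ≤ #{U : Set X | U ∈ B ∧ ∀ y, a < π y → π y < b → y ∈ U}) :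
    ∃ w : B, ∀ i, c i ≤ #{q : B // w ≤ q} := by
  classical
  have := noMaxOrder_of_aleph0_lt_cof hT
  have h' : ∀ i, ∃ g : T → T, ∀ b ∈ S i, g b < b ∧
      c i ≤ #{U : Set X | U ∈ B ∧ ∀ y, (g b : WithTop T) < π y → π y < b → y ∈ U} := fun i => by
    have : ∀ b : T, ∃ a : T, b ∈ S i → a < b ∧
        c i ≤ #{U : Set X | U ∈ B ∧ ∀ y, (a : WithTop T) < π y → π y < b → y ∈ U} := fun b => by
      by_cases hb : b ∈ S i
      · obtain ⟨a, ha, hca⟩ := h i b hb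
        lift a to T using (ha.trans_le le_top).ne
        exact ⟨a, fun _ => ⟨WithTop.coe_lt_coe.1 ha, hca⟩⟩
      · exact ⟨b, fun hb' => (hb hb').elim⟩
    choose g hg using this
    exact ⟨g, hg⟩
  choose g hg using h'
  choose d hd using fun i => (hS i).bddAbove_setOf_forall_le hT (g i) fun b hb => (hg i b hb).1
  obtain ⟨u, hu⟩ := bddAbove_range_of_mk_lt_cof d hι
  have hnext : ∀ x : T, ∃ y, x < y ∧ ∀ z, x < z → y ≤ z := fun x =>
    ⟨wellFounded_lt.min (Ioi x) (exists_gt x), wellFounded_lt.min_mem (Ioi x) _,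
      fun z hz => wellFounded_lt.min_le (s := Ioi x) hz⟩
  choose nxt hlt hnxt using hnext
  obtain ⟨v, hv⟩ := exists_gt u
  -- Points over three successive indices make the open interval nonempty; the last index is still
  -- below `b`, as `b` is a limit.
  obtain ⟨x₀, hx₀⟩ := hsurj v
  obtain ⟨x₁, hx₁⟩ := hsurj (nxt v)
  obtain ⟨x₂, hx₂⟩ := hsurj (nxt (nxt v))
  have h₀₁ : x₀ < x₁ := hπ.reflect_lt (by simpa [hx₀, hx₁] using hlt v)
  have h₁₂ : x₁ < x₂ := hπ.reflect_lt (by simpa [hx₁, hx₂] using hlt (nxt v))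
  obtain ⟨w, hw, -, hwJ⟩ := hB.exists_subset_of_mem_open
    (mem_Ioo.2 ⟨h₀₁, h₁₂⟩) (isOpen_Ioo (a := x₀) (b := x₂))
  refine ⟨⟨w, hw⟩, fun i => ?_⟩
  have hvi : v ∉ {e : T | ∀ b ∈ S i, e < b → e ≤ g i b} := fun hvi =>
    ((hd i hvi).trans (hu ⟨i, rfl⟩)).not_gt hv
  obtain ⟨b, hb, hvb, hgv⟩ : ∃ b ∈ S i, v < b ∧ g i b < v := by
    simpa using hvi
  have hbnext : ∀ x < b, nxt x < b := fun x hx => by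
    obtain ⟨y, hyb, hxy⟩ := (hlim i b hb).lt_iff_exists_lt.1 hx
    exact (hnxt x y hxy).trans_lt hyb
  refine (hg i b hb).2.trans (mk_le_of_injective (f := fun U =>
    (⟨⟨U.1, U.2.1⟩, fun y hy => U.2.2 y ?_ ?_⟩ : {q : B // (⟨w, hw⟩ : B) ≤ q})) ?_)
  · refine (WithTop.coe_lt_coe.2 hgv).trans_le ?_
    rw [← hx₀]
    exact hπ (hwJ hy).1.le
  · refine (hπ (hwJ hy).2.le).trans_lt ?_
    rw [hx₂]
    exact WithTop.coe_lt_coe.2 (hbnext _ (hbnext _ hvb))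
  · intro U V hUV
    exact Subtype.ext (congrArg (fun q => q.1.1) hUV)

end Topology

/-! ### Completeness of lexicographic sums and of reversed ordinals. -/

theorem Sigma.Lex.exists_isLUB {W : Type*} {F : W → Type*} [LinearOrder W]
    [∀ x, LinearOrder (F x)] (hW : ∀ s : Set W, ∃ a, IsLUB s a)
    (hF : ∀ x, ∀ s : Set (F x), ∃ a, IsLUB s a) (s : Set (Σₗ x, F x)) : ∃ a, IsLUB s a := by
  obtain ⟨b, hb⟩ := hW ((fun y => (ofLex y).1) '' s)
  -- If `s` misses the fibre over `b`, this is the supremum of the empty set, the least point of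
  -- that fibre.
  obtain ⟨c, hc⟩ := hF b {a | toLex ⟨b, a⟩ ∈ s}
  refine ⟨toLex ⟨b, c⟩, ?_, ?_⟩
  · rintro ⟨x, a⟩ hs
    rcases (hb.1 ⟨_, hs, rfl⟩ : x ≤ b).lt_or_eq with h | rfl
    · exact Sigma.Lex.left _ _ h
    · exact Sigma.Lex.right _ _ (hc.1 hs)
  · rintro ⟨x, a⟩ hz
    have hbx : b ≤ x := hb.2 <| by
      rintro _ ⟨y, hy, rfl⟩
      rcases Sigma.Lex.le_def.1 (hz hy) with h | ⟨h, -⟩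
      · exact h.le
      · exact h.le
    rcases hbx.lt_or_eq with h | rfl
    · exact Sigma.Lex.left _ _ h
    · refine Sigma.Lex.right _ _ (hc.2 fun d hd => ?_)
      rcases Sigma.Lex.le_def.1 (hz hd) with h | ⟨_, h⟩
      · exact (lt_irrefl _ h).elim
      · exact h

/-- After reversal `t` is the least point of its fibre, and the cofinality below it becomes the
coinitiality above it. -/
theorem Ordinal.ToType.exists_isTop_cof_Iio {o c : Ordinal.{u}} (h : o = c + 1) :
    ∃ t : o.ToType, IsTop t ∧ Order.cof (Iio t) = c.cof := by
  subst h
  have hc : c < Ordinal.type (α := (c + 1).ToType) (· < ·) := by simp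
  refine ⟨Ordinal.enum (α := (c + 1).ToType) (· < ·) ⟨c, hc⟩, fun y => ?_, ?_⟩
  · rw [← Ordinal.typein_le_typein', Ordinal.typein_enum, ← Order.lt_add_one_iff]
    exact Ordinal.typein_lt_self y
  · rw [Order.cof_Iio, Ordinal.typein_enum]

theorem exists_isLUB_orderDual {A : Type*} [LinearOrder A] [WellFoundedLT A]
    (h : ∃ t : A, IsTop t) (s : Set Aᵒᵈ) : ∃ a, IsLUB s a := by
  rcases s.eq_empty_or_nonempty with rfl | hs
  · obtain ⟨t, ht⟩ := h
    exact ⟨OrderDual.toDual t, by simpa using ht⟩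
  · refine ⟨OrderDual.toDual (wellFounded_lt.min (OrderDual.toDual ⁻¹' s) hs), ?_, ?_⟩
    · exact fun a ha => wellFounded_lt.min_le (s := OrderDual.toDual ⁻¹' s) ha
    · exact fun a ha => ha (wellFounded_lt.min_mem (OrderDual.toDual ⁻¹' s) hs)

/-! ### Coordinates, size and one-sided neighbourhoods in the lexicographic sum. -/

namespace LexSum

variable {κ : Cardinal.{u}} {o : WithTop (SuccCofType κ) → Ordinal.{u}}

/-- The first coordinate of a point of the lexicographic sum. -/
def fst (y : LexSum κ o) : WithTop (SuccCofType κ) :=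
  Sigma.fst y

/-- The point of the lexicographic sum with given coordinates. -/
def mk (x : WithTop (SuccCofType κ)) (a : (o x).ToType) : LexSum κ o :=
  (⟨x, OrderDual.toDual a⟩ : Σ x : WithTop (SuccCofType κ), ((o x).ToType)ᵒᵈ)

@[simp]
theorem fst_mk (x : WithTop (SuccCofType κ)) (a : (o x).ToType) : fst (mk x a) = x :=
  rfl

theorem exists_eq_mk (y : LexSum κ o) : ∃ x a, y = mk x a :=
  ⟨y.1, OrderDual.ofDual y.2, rfl⟩

theorem monotone_fst : Monotone (fst : LexSum κ o → _) := fun y z h => by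
  rcases Sigma.Lex.le_def.1 h with h | ⟨h, -⟩
  · exact h.le
  · exact h.le

theorem mk_lt_mk_of_lt {x y : WithTop (SuccCofType κ)} (h : x < y) (a : (o x).ToType)
    (b : (o y).ToType) : mk x a < mk y b :=
  Sigma.Lex.left _ _ h

@[simp]
theorem mk_lt_mk {x : WithTop (SuccCofType κ)} {a b : (o x).ToType} :
    mk x a < mk x b ↔ b < a := by
  refine ⟨fun h => ?_, fun h => Sigma.Lex.right _ _ h⟩
  rcases Sigma.Lex.lt_def.1 h with h | ⟨_, h⟩
  · exact (lt_irrefl _ h).elim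
  · exact h

theorem surjective_fst (h : ∀ x, o x ≠ 0) : Function.Surjective (fst : LexSum κ o → _) := fun x =>
  have : Nonempty (o x).ToType := by simpa using h x
  ⟨mk x (Classical.arbitrary _), rfl⟩

theorem mk_le {c : Cardinal.{u}} (hc : ℵ₀ ≤ c) (hκ : succ κ.ord.cof ≤ c) (h : ∀ x, (o x).card ≤ c) :
    #(LexSum κ o) ≤ c := by
  have hW : #(WithTop (SuccCofType κ)) ≤ c := by
    refine (mk_option (α := SuccCofType κ)).trans_le ?_
    rw [mk_ord_toType]
    exact add_le_of_le hc hκ (one_le_aleph0.trans hc)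
  refine (mk_sigma fun x : WithTop (SuccCofType κ) => ((o x).ToType)ᵒᵈ).trans_le ?_
  refine (sum_le_sum _ (fun _ => c) fun x => ?_).trans ?_
  · exact (mk_toType (o x)).trans_le (h x)
  · rw [sum_const']
    exact mul_le_of_le hc hW le_rfl

theorem fst_lt_of_lt_mk {x : WithTop (SuccCofType κ)} {t : (o x).ToType} (ht : IsTop t)
    {y : LexSum κ o} (h : y < mk x t) : fst y < x := by
  obtain ⟨z, a, rfl⟩ := exists_eq_mk y
  refine (monotone_fst h.le).lt_of_ne fun hz => ?_
  obtain rfl : z = x := hz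
  exact (ht a).not_gt (mk_lt_mk.1 h)

theorem exists_between_mk {x : WithTop (SuccCofType κ)} {t : (o x).ToType}
    {c : Cardinal.{u}} (hc : ℵ₀ ≤ c) (ht : cof (Iio t) = c) (ι : Type u) (f : ι → LexSum κ o)
    (hι : #ι < c) (hf : ∀ j, mk x t < f j) : ∃ i, mk x t < i ∧ ∀ j, i < f j := by
  have hne : Nonempty (Iio t) := cof_ne_zero_iff.1 (ht ▸ (aleph0_pos.trans_le hc).ne')
  have hmax : NoMaxOrder (Iio t) :=
    (noTopOrder_iff_noMaxOrder _).1 (one_lt_cof_iff.1 (ht ▸ one_lt_aleph0.trans_le hc))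
  have hle : ∀ j, ∃ a : Iio t, mk x a.1 ≤ f j := fun j => by
    obtain ⟨z, b, hb⟩ := exists_eq_mk (f j)
    have hj := hf j
    rw [hb] at hj ⊢
    rcases (monotone_fst hj.le : x ≤ z).lt_or_eq with h | rfl
    · exact ⟨Classical.arbitrary _, (mk_lt_mk_of_lt h _ _).le⟩
    · exact ⟨⟨b, mk_lt_mk.1 hj⟩, le_rfl⟩
  choose g hg using hle
  obtain ⟨m, hm⟩ := bddAbove_range_of_mk_lt_cof g (ht ▸ hι)
  obtain ⟨i, hi⟩ := exists_gt m
  exact ⟨mk x i.1, mk_lt_mk.2 i.2, fun j =>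
    (mk_lt_mk.2 ((hm ⟨j, rfl⟩).trans_lt hi)).trans_le (hg j)⟩

end LexSum

/-! ### Compactness and Noetherian type of the construction. -/

namespace IsStationaryLexData

variable {κ : Cardinal.{u}} {S : CofType κ → Set (SuccCofType κ)} {k : CofType κ → Cardinal.{u}}
  {o : WithTop (SuccCofType κ) → Ordinal.{u}}

theorem fibre_eq (h : IsStationaryLexData κ S k o) (x : WithTop (SuccCofType κ)) :
    (∃ a, o x = (k a).ord + 1) ∨ o x = 0 + 1 := by
  by_cases hx : ∀ a, ∀ b ∈ S a, x ≠ (b : WithTop (SuccCofType κ))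
  · exact .inr ((h.fibre_one x hx).trans (zero_add 1).symm)
  · push Not at hx
    obtain ⟨a, b, hb, rfl⟩ := hx
    exact .inl ⟨a, h.fibre_mem a b hb⟩

theorem exists_fibre_eq (h : IsStationaryLexData κ S k o) (x : WithTop (SuccCofType κ)) :
    ∃ c, o x = c + 1 := by
  obtain ⟨a, ha⟩ | hx := h.fibre_eq x
  · exact ⟨_, ha⟩
  · exact ⟨_, hx⟩

theorem compactSpace (h : IsStationaryLexData κ S k o) : CompactSpace (LexSum κ o) := by
  refine compactSpace_of_forall_exists_isLUB (Sigma.Lex.exists_isLUB (fun s => ?_) fun x s => ?_)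
  · exact exists_isLUB_of_bddAbove (OrderTop.bddAbove s)
  · obtain ⟨c, hc⟩ := h.exists_fibre_eq x
    obtain ⟨t, ht, -⟩ := Ordinal.ToType.exists_isTop_cof_Iio hc
    exact exists_isLUB_orderDual ⟨t, ht⟩ s

theorem mk_lexSum_le (h : IsStationaryLexData κ S k o) (hκ : κ.IsSingular) :
    #(LexSum κ o) ≤ κ := by
  refine LexSum.mk_le hκ.aleph0_le (succ_le_of_lt hκ.cof_ord_lt) fun x => ?_
  obtain ⟨a, ha⟩ | hx := h.fibre_eq x
  · rw [ha, Ordinal.card_add, card_ord, Ordinal.card_one]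
    exact add_le_of_le hκ.aleph0_le (h.isLUB.1 ⟨a, rfl⟩) (one_le_aleph0.trans hκ.aleph0_le)
  · simpa [hx] using one_le_aleph0.trans hκ.aleph0_le

theorem exists_le_mk_superset (h : IsStationaryLexData κ S k o) (hκ : κ.IsSingular)
    {B : Set (Set (LexSum κ o))} (hB : TopologicalSpace.IsTopologicalBasis B) :
    ∃ w : B, κ ≤ #{q : B // w ≤ q} := by
  have hcof : ℵ₀ ≤ κ.ord.cof :=
    Ordinal.aleph0_le_cof_iff.2 (Ordinal.one_lt_cof_iff.2 (isSuccLimit_ord hκ.aleph0_le))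
  have hT : cof (SuccCofType κ) = succ κ.ord.cof := by
    rw [Ordinal.cof_toType, (isRegular_succ hcof).cof_ord]
  have hT₀ : ℵ₀ < cof (SuccCofType κ) := by
    rw [hT]
    exact hcof.trans_lt (lt_succ _)
  have hsurj := LexSum.surjective_fst (o := o) fun x => by
    obtain ⟨c, hc⟩ := h.exists_fibre_eq x
    simp [hc]
  have hlim : ∀ a, ∀ b ∈ S a, IsSuccLimit b := fun a b hb => by
    have : b ∈ ⋃ a, S a := mem_iUnion.2 ⟨a, hb⟩
    rwa [h.iUnion_eq] at this
  -- Only fibres with `k a` above `cf κ` are used: the at most `cf κ` indices below `b` must be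
  -- fewer than `k a`.
  let ι : Type u := {a : CofType κ // κ.ord.cof < k a}
  have hι : #ι < cof (SuccCofType κ) := by
    rw [hT, lt_succ_iff]
    exact (mk_subtype_le _).trans_eq (mk_ord_toType _)
  obtain ⟨w, hw⟩ := exists_forall_le_mk_superset hT₀ hι (π := LexSum.fst) LexSum.monotone_fst hsurj
    (S := fun i : ι => S i.1) (fun i => h.stationary i.1) (fun i => hlim i.1)
    (c := fun i => k i.1) hB fun i b hb => by
      obtain ⟨t, ht, htc⟩ := Ordinal.ToType.exists_isTop_cof_Iio (h.fibre_mem i.1 b hb)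
      rw [(h.regular i.1).cof_ord] at htc
      refine exists_le_mk_setOf_superset LexSum.monotone_fst (p := LexSum.mk b t)
        (h.regular i.1) ?_ ?_ (fun y hy => LexSum.fst_lt_of_lt_mk ht hy)
        (LexSum.exists_between_mk (h.regular i.1).aleph0_le htc) hB
      · refine lt_of_le_of_lt ?_ i.2
        have : Iio (b : WithTop (SuccCofType κ)) = (↑) '' Iio b :=
          WithTop.image_coe_Iio.symm
        rw [LexSum.fst_mk, this]
        refine mk_image_le.trans (lt_succ_iff.1 ?_)
        simpa using mk_Iio_lt b (by simp)
      · obtain ⟨a, ha⟩ := not_isMin_iff.1 (hlim i.1 b hb).not_isMin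
        obtain ⟨y, hy⟩ := hsurj (a : WithTop (SuccCofType κ))
        refine ⟨y, LexSum.monotone_fst.reflect_lt ?_⟩
        rw [hy]
        exact WithTop.coe_lt_coe.2 ha
  refine ⟨w, h.isLUB.2 ?_⟩
  rintro _ ⟨a, rfl⟩
  -- Singularity puts `cf κ` below some `k a₀`, so the discarded indices do not affect the supremum.
  obtain ⟨_, ⟨a₀, rfl⟩, ha₀⟩ := (lt_isLUB_iff h.isLUB).1 hκ.cof_ord_lt
  refine (h.strictMono.monotone (le_max_left a a₀)).trans (hw ⟨max a a₀, ?_⟩)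
  exact ha₀.trans_le (h.strictMono.monotone (le_max_right a a₀))

theorem noetherianType_eq (h : IsStationaryLexData κ S k o) (hκ : κ.IsSingular) :
    noetherianType (LexSum κ o) = succ κ := by
  have hmem : succ κ ∈ {μ : Cardinal.{u} | ℵ₀ ≤ μ ∧ ∃ B : Set (Set (LexSum κ o)),
      TopologicalSpace.IsTopologicalBasis B ∧ IsOpLike μ B} := by
    obtain ⟨B, hB, hBκ⟩ := exists_isTopologicalBasis_mk_le hκ.aleph0_le (h.mk_lexSum_le hκ)
    exact ⟨hκ.aleph0_le.trans (le_succ κ), B, hB, fun p =>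
      lt_succ_iff.2 ((mk_subtype_le _).trans hBκ)⟩
  refine le_antisymm (csInf_le' hmem) (le_csInf ⟨_, hmem⟩ ?_)
  rintro μ ⟨-, B, hB, hμ⟩
  obtain ⟨w, hw⟩ := h.exists_le_mk_superset hκ hB
  exact succ_le_of_lt (hw.trans_lt (hμ w))

end IsStationaryLexData

/-! ### Existence of the data, and the theorem. -/

theorem exists_isStationaryLexData {κ : Cardinal.{u}} (hκ : κ.IsSingular) :
    ∃ (S : CofType κ → Set (SuccCofType κ)) (k : CofType κ → Cardinal.{u})
      (o : WithTop (SuccCofType κ) → Ordinal.{u}), IsStationaryLexData κ S k o := by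
  classical
  have hcof : ℵ₀ ≤ κ.ord.cof :=
    Ordinal.aleph0_le_cof_iff.2 (Ordinal.one_lt_cof_iff.2 (isSuccLimit_ord hκ.aleph0_le))
  obtain ⟨S, hS, hd, hU⟩ := exists_stationary_partition (T := SuccCofType κ) (ι := CofType κ)
    (by rwa [mk_ord_toType])
    (by rw [Ordinal.cof_toType, (isRegular_succ hcof).cof_ord, mk_ord_toType])
    (fun x => by
      rw [mk_ord_toType, ← lt_succ_iff]
      simpa using mk_Iio_lt x (by simp))
  obtain ⟨k, hk, hmono, hlub⟩ :=
    exists_strictMono_isRegular_isLUB (hcof.trans_lt hκ.cof_ord_lt) hκ.isSuccLimit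
  have ho : ∀ x : WithTop (SuccCofType κ), ∃ c : Ordinal.{u},
      (∀ a, ∀ b ∈ S a, x = b → c = (k a).ord + 1) ∧
      ((∀ a, ∀ b ∈ S a, x ≠ (b : WithTop (SuccCofType κ))) → c = 1) := fun x => by
    by_cases hx : ∀ a, ∀ b ∈ S a, x ≠ (b : WithTop (SuccCofType κ))
    · exact ⟨1, fun a b hb hxb => (hx a b hb hxb).elim, fun _ => rfl⟩
    · refine (not_forall.1 hx).elim fun a ha => ?_
      push Not at ha
      obtain ⟨b, hb, rfl⟩ := ha
      refine ⟨(k a).ord + 1, fun a' b' hb' hbb => ?_, fun hx' => (hx hx').elim⟩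
      obtain rfl := WithTop.coe_injective hbb
      by_contra hne
      exact Set.disjoint_left.1 (hd fun h : a = a' => hne (by rw [h])) hb hb'
  choose o ho₁ ho₂ using ho
  exact ⟨S, k, o, hS, hd, hU, hk, hmono, hlub, fun a b hb => ho₁ b a b hb rfl, ho₂⟩

theorem mainTheorem7 (κ : Cardinal.{u}) (hκ : κ.IsSingular) :
    (∃ (Y : Type u) (_ : LinearOrder Y) (_ : TopologicalSpace Y),
      OrderTopology Y ∧ CompactSpace Y ∧ noetherianType Y = succ κ) ∧
    (∃ (S : CofType κ → Set (SuccCofType κ)) (k : CofType κ → Cardinal.{u})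
      (o : WithTop (SuccCofType κ) → Ordinal.{u}), IsStationaryLexData κ S k o) ∧
    (∀ (S : CofType κ → Set (SuccCofType κ)) (k : CofType κ → Cardinal.{u})
      (o : WithTop (SuccCofType κ) → Ordinal.{u}), IsStationaryLexData κ S k o →
        CompactSpace (LexSum κ o) ∧ noetherianType (LexSum κ o) = succ κ) := by
  obtain ⟨S, k, o, h⟩ := exists_isStationaryLexData hκ
  exact ⟨⟨LexSum κ o, inferInstance, inferInstance, inferInstance, h.compactSpace,
    h.noetherianType_eq hκ⟩, ⟨S, k, o, h⟩, fun S k o h => ⟨h.compactSpace, h.noetherianType_eq hκ⟩⟩
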